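/- All spaces are based. For a based space $Z$ let $\mathrm{aut}_1 Z$ be the space, with the compact-open topology, of unbased self-maps of $Z$ that are freely homotopic to the identity, based at the identity, and let $\omega\colon \mathrm{aut}_1 Z\to Z$ be evaluation at the base point. For a based space $A$, with reduced suspension $\Sigma A$, let $[\Sigma A,Z]$ be the group of based homotopy classes of based maps $\Sigma A\to Z$, and let $\mathcal{G}(\Sigma A,Z)\subseteq[\Sigma A,Z]$ be the image of $\omega_*\colon[\Sigma A,\mathrm{aut}_1 Z]\to[\Sigma A,Z]$ (the generalized Gottlieb group). For $n\ge 1$ let $G_n(Z)\subseteq\pi_n(Z)$ be the image of $\omega_\#\colon\pi_n(\mathrm{aut}_1 Z)\to\pi_n(Z)$ (the $n$th Gottlieb group). Let $X$ and $Y$ be well-pointed (the inclusion of the base point is a cofibration), locally compact Hausdorff spaces, with $X$ connected and $Y$ path-connected. Let $\mathrm{map}(X,Y;0)$ be the space, with the compact-open topology, of unbased maps $X\to Y$ that are homotopic to the constant map at the base point of $Y$, based at that constant map. Then for every well-pointed, locally compact Hausdorff space $A$ (not necessarily connected), the groups $\mathcal{G}(\Sigma A,\mathrm{map}(X,Y;0))$,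 $\mathcal{G}(\Sigma A,Y)$ and $\mathcal{G}(\Sigma(A\wedge X),Y)$ are abelian, and there is an isomorphism of abelian groups $$\mathcal{G}\big(\Sigma A,\mathrm{map}(X,Y;0)\big)\cong\mathcal{G}(\Sigma A,Y)\oplus\mathcal{G}(\Sigma(A\wedge X),Y).$$ Moreover, for every $n\ge 1$, the groups $G_n(\mathrm{map}(X,Y;0))$, $G_n(Y)$ and $\mathcal{G}(\Sigma^nX,Y)$ are abelian, and there is an isomorphism of abelian groups $$G_n\big(\mathrm{map}(X,Y;0)\big)\cong G_n(Y)\oplus\mathcal{G}(\Sigma^nX,Y),$$ where $\Sigma^nX$ is the $n$-fold reduced suspension. -/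

import Mathlib

open scoped unitInterval Topology

universe u v w

/-- A based topological space. -/
structure BasedSpace : Type (u + 1) where
  carrier : Type u
  [top : TopologicalSpace carrier]
  pt : carrier

attribute [instance] BasedSpace.top

namespace BasedSpace

instance : CoeSort BasedSpace.{u} (Type u) := ⟨BasedSpace.carrier⟩

/-- The inclusion of the base point is a (Hurewicz) cofibration, i.e. it has the homotopy extension
property: a map `f` on `X`, together with a path starting at `f pt`, extends to a homotopy on `X`.
(Test spaces in the universe of `X` suffice: the mapping cylinder of the base point, which is the
universal test space, lives there.) -/
def WellPointed (X : BasedSpace.{u}) : Prop :=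
  ∀ (Z : Type u) [TopologicalSpace Z] (f : C(X, Z)) (γ : C(I, Z)), γ 0 = f X.pt →
    ∃ H : C(X × I, Z), (∀ x, H (x, 0) = f x) ∧ ∀ t, H (X.pt, t) = γ t

/-- The equivalence relation on `T` that identifies all points of `S` with one another. -/
def collapseSetoid {T : Type u} (S : Set T) : Setoid T where
  r x y := x = y ∨ (x ∈ S ∧ y ∈ S)
  iseqv := by
    refine ⟨fun x => Or.inl rfl, ?_, ?_⟩
    · rintro x y (h | h)
      · exact Or.inl h.symm
      · exact Or.inr h.symm
    · rintro x y z (rfl | h) (rfl | h')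
      · exact Or.inl rfl
      · exact Or.inr h'
      · exact Or.inr h
      · exact Or.inr ⟨h.1, h'.2⟩

/-- The quotient space `T / S`, based at the image of `p` (used with `p ∈ S`). -/
def collapse {T : Type u} [TopologicalSpace T] (S : Set T) (p : T) : BasedSpace.{u} where
  carrier := Quotient (collapseSetoid S)
  pt := Quotient.mk (collapseSetoid S) p

/-- The subspace `A × {0, 1} ∪ {pt} × I` of `A × I`. -/
def suspSet (A : BasedSpace.{u}) : Set (A × I) := {p | p.1 = A.pt ∨ p.2 = 0 ∨ p.2 = 1}

/-- The reduced suspension `ΣA = (A × I) / (A × {0, 1} ∪ {pt} × I)`. -/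
def susp (A : BasedSpace.{u}) : BasedSpace.{u} := collapse A.suspSet (A.pt, 0)

/-- The `n`-fold reduced suspension `Σⁿ A`. -/
def iterSusp (A : BasedSpace.{u}) : ℕ → BasedSpace.{u}
  | 0 => A
  | n + 1 => (A.iterSusp n).susp

/-- The smash product `A ∧ X = (A × X) / (A × {pt} ∪ {pt} × X)`. -/
def smash (A : BasedSpace.{u}) (X : BasedSpace.{v}) : BasedSpace.{max u v} :=
  collapse {p : A × X | p.1 = A.pt ∨ p.2 = X.pt} (A.pt, X.pt)

/-- `map(X, Y; 0)`: the component of the null map in the space of unbased maps `X → Y`, that is, the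
subspace of the maps homotopic to the constant map at the base point, with the compact-open
topology; it is based at this constant map. -/
def mapNull (X : BasedSpace.{u}) (Y : BasedSpace.{v}) : BasedSpace.{max u v} where
  carrier := {f : C(X, Y) // f.Homotopic (ContinuousMap.const X Y.pt)}
  pt := ⟨ContinuousMap.const X Y.pt, ContinuousMap.Homotopic.refl _⟩

/-- `aut₁ Z`: the space of the unbased self-maps of `Z` that are freely homotopic to the identity
(these are automatically homotopy equivalences), with the compact-open topology, based at the
identity. -/
def autOne (Z : BasedSpace.{u}) : BasedSpace.{u} where
  carrier := {f : C(Z, Z) // f.Homotopic (ContinuousMap.id Z)}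
  pt := ⟨ContinuousMap.id Z, ContinuousMap.Homotopic.refl _⟩

/-- Based maps. -/
def BasedMap (A : BasedSpace.{u}) (Z : BasedSpace.{v}) : Type (max u v) :=
  {f : C(A, Z) // f A.pt = Z.pt}

/-- The evaluation map `ω : aut₁ Z → Z` at the base point. -/
def omega (Z : BasedSpace.{u}) : BasedMap Z.autOne Z :=
  ⟨⟨fun f => f.1 Z.pt, (continuous_eval_const Z.pt).comp continuous_subtype_val⟩, rfl⟩

/-- Composition of based maps. -/
def BasedMap.comp {A : BasedSpace.{u}} {Z : BasedSpace.{v}} {W : BasedSpace.{w}}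
    (φ : BasedMap Z W) (f : BasedMap A Z) : BasedMap A W :=
  ⟨φ.1.comp f.1, by rw [ContinuousMap.comp_apply, f.2, φ.2]⟩

/-- Based homotopy of based maps. -/
instance basedHomotopySetoid (A : BasedSpace.{u}) (Z : BasedSpace.{v}) : Setoid (BasedMap A Z) where
  r f g := f.1.HomotopicRel g.1 {A.pt}
  iseqv := ⟨fun f => ContinuousMap.HomotopicRel.refl f.1, fun h => h.symm, fun h h' => h.trans h'⟩

/-- `[A, Z]`: based homotopy classes of based maps. -/
def HomotopyClasses (A : BasedSpace.{u}) (Z : BasedSpace.{v}) : Type (max u v) :=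
  Quotient (basedHomotopySetoid A Z)

section Suspension

variable {A : BasedSpace.{u}} {Z : BasedSpace.{v}}

/-- The point `[a, t]` of `ΣA`. -/
def suspMk (a : A) (t : I) : A.susp := Quotient.mk (collapseSetoid A.suspSet) (a, t)

theorem suspMk_quot : Topology.IsQuotientMap (fun p : A × I => (suspMk p.1 p.2 : A.susp)) :=
  isQuotientMap_quot_mk

theorem suspMk_eq_pt {a : A} {t : I} (h : (a, t) ∈ A.suspSet) : suspMk a t = A.susp.pt :=
  Quotient.sound (s := collapseSetoid A.suspSet) (Or.inr ⟨h, Or.inl rfl⟩)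

/-- A based map on `ΣA` from a map on `A × I`. -/
def suspLift (F : C(A × I, Z)) (hF : ∀ p ∈ A.suspSet, F p = Z.pt) : BasedMap A.susp Z :=
  ⟨⟨Quotient.lift (s := collapseSetoid A.suspSet) F (by
      rintro p q (rfl | h)
      · rfl
      · rw [hF p h.1, hF q h.2]), F.continuous.quotient_lift _⟩, hF _ (Or.inl rfl)⟩

theorem suspLift_mk (F : C(A × I, Z)) (hF : ∀ p ∈ A.suspSet, F p = Z.pt) (a : A) (t : I) :
    (suspLift F hF).1 (suspMk a t) = F (a, t) := rfl

/-- Two based maps on `ΣA` are homotopic if there is a suitable homotopy on `A × I`. -/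
theorem homotopic_of_family {f g : BasedMap A.susp Z} (H : C(I × (A × I), Z))
    (hH : ∀ s, ∀ p ∈ A.suspSet, H (s, p) = Z.pt)
    (h0 : ∀ a t, H (0, (a, t)) = f.1 (suspMk a t)) (h1 : ∀ a t, H (1, (a, t)) = g.1 (suspMk a t)) :
    f ≈ g := by
  let K : I × A.susp → Z := fun q => (suspLift (H.comp ⟨fun p => (q.1, p), by fun_prop⟩)
    (fun p hp => hH q.1 p hp)).1 q.2
  have hK : Continuous K :=
    (suspMk_quot (A := A)).continuous_lift_prod_right (g := K) H.continuous
  refine ⟨⟨⟨⟨K, hK⟩, ?_, ?_⟩, ?_⟩⟩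
  · rintro ⟨a, t⟩
    exact h0 a t
  · rintro ⟨a, t⟩
    exact h1 a t
  · rintro s x rfl
    exact (hH s _ (Or.inl rfl)).trans f.2.symm

/-- The loop `t ↦ f [a, t]`. -/
def loopAt (f : BasedMap A.susp Z) (a : A) : Path Z.pt Z.pt where
  toFun t := f.1 (suspMk a t)
  continuous_toFun := f.1.continuous.comp
    (suspMk_quot.continuous.comp (Continuous.prodMk_right a))
  source' := by rw [suspMk_eq_pt (Or.inr (Or.inl rfl)), f.2]
  target' := by rw [suspMk_eq_pt (Or.inr (Or.inr rfl)), f.2]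

theorem continuous_loopAt (f : BasedMap A.susp Z) : Continuous ↿(loopAt f) :=
  f.1.continuous.comp suspMk_quot.continuous

theorem loopAt_pt (f : BasedMap A.susp Z) : loopAt f A.pt = Path.refl Z.pt := by
  ext t
  change f.1 (suspMk A.pt t) = Z.pt
  rw [suspMk_eq_pt (Or.inl rfl), f.2]

/-- The constant based map. -/
def suspOne : BasedMap A.susp Z := ⟨ContinuousMap.const _ Z.pt, rfl⟩

/-- The based map `f · g` given by `[a, t] ↦ f [a, 2t]` for `t ≤ 1/2` and `[a, t] ↦ g [a, 2t - 1]`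
for `t ≥ 1/2`. -/
noncomputable def suspMul (f g : BasedMap A.susp Z) : BasedMap A.susp Z :=
  suspLift ⟨fun p => ((loopAt f p.1).trans (loopAt g p.1)) p.2,
    Path.trans_continuous_family _ (continuous_loopAt f) _ (continuous_loopAt g)⟩ (by
      rintro ⟨a, t⟩ (rfl | rfl | rfl)
      · simp [loopAt_pt]
      · simp
      · simp)

/-- The based map `[a, t] ↦ f [a, 1 - t]`. -/
def suspInv (f : BasedMap A.susp Z) : BasedMap A.susp Z :=
  suspLift ⟨fun p => (loopAt f p.1).symm p.2,
    Path.symm_continuous_family _ (continuous_loopAt f)⟩ (by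
      rintro ⟨a, t⟩ (rfl | rfl | rfl)
      · simp [loopAt_pt]
      · simp
      · simp)

theorem loopAt_mul (f g : BasedMap A.susp Z) (a : A) :
    loopAt (suspMul f g) a = (loopAt f a).trans (loopAt g a) := rfl

theorem loopAt_inv (f : BasedMap A.susp Z) (a : A) : loopAt (suspInv f) a = (loopAt f a).symm := rfl

theorem loopAt_one (a : A) : loopAt (suspOne (Z := Z)) a = Path.refl Z.pt := rfl

/-- Reparametrizing the suspension coordinate does not change the homotopy class. -/
theorem homotopic_of_reparam {f g : BasedMap A.susp Z} (k : BasedMap A.susp Z) (h : C(I × I, I))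
    (hz : ∀ s, h (s, 0) = 0 ∨ h (s, 0) = 1) (ho : ∀ s, h (s, 1) = 0 ∨ h (s, 1) = 1)
    (h0 : ∀ a t, loopAt f a t = loopAt k a (h (0, t)))
    (h1 : ∀ a t, loopAt g a t = loopAt k a (h (1, t))) : f ≈ g := by
  refine homotopic_of_family ⟨fun q => loopAt k q.2.1 (h (q.1, q.2.2)),
    (continuous_loopAt k).comp (f := fun q : I × (A × I) => (q.2.1, h (q.1, q.2.2)))
      (by fun_prop)⟩ ?_ (fun a t => (h0 a t).symm) (fun a t => (h1 a t).symm)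
  rintro s ⟨a, t⟩ (rfl | rfl | rfl)
  · simp [loopAt_pt]
  · rcases hz s with e | e <;> simp [e]
  · rcases ho s with e | e <;> simp [e]

theorem homotopic_of_path_reparam {f g : BasedMap A.susp Z} (φ : I → I) (hφ : Continuous φ)
    (φ0 : φ 0 = 0) (φ1 : φ 1 = 1) (h : ∀ a, loopAt f a = (loopAt g a).reparam φ hφ φ0 φ1) :
    f ≈ g := by
  let e : Path (0 : I) 1 := ⟨⟨id, continuous_id⟩, rfl, rfl⟩
  let K := Path.Homotopy.reparam e φ hφ φ0 φ1
  refine Setoid.symm (homotopic_of_reparam g K.toContinuousMap (fun s => Or.inl (K.source s))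
    (fun s => Or.inr (K.target s)) (fun a t => ?_) (fun a t => ?_))
  · exact congrArg (loopAt g a) (K.apply_zero t).symm
  · rw [h a]
    exact congrArg (loopAt g a) (K.apply_one t).symm

theorem suspMul_congr {f f' g g' : BasedMap A.susp Z} (hf : f ≈ f') (hg : g ≈ g') :
    suspMul f g ≈ suspMul f' g' := by
  obtain ⟨F⟩ := hf
  obtain ⟨G⟩ := hg
  let slice {p q : BasedMap A.susp Z} (P : p.1.HomotopyRel q.1 {A.susp.pt}) (s : I) :
      BasedMap A.susp Z := ⟨⟨fun x => P (s, x), by fun_prop⟩, (P.eq_fst s rfl).trans p.2⟩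
  have hs {p q : BasedMap A.susp Z} (P : p.1.HomotopyRel q.1 {A.susp.pt}) :
      Continuous ↿(fun i : I × A => loopAt (slice P i.1) i.2) :=
    P.continuous.comp ((continuous_fst.comp continuous_fst).prodMk
      ((suspMk_quot (A := A)).continuous.comp
        (f := fun q : (I × A) × I => (q.1.2, q.2)) (by fun_prop)))
  have h0 {p q : BasedMap A.susp Z} (P : p.1.HomotopyRel q.1 {A.susp.pt}) : slice P 0 = p :=
    Subtype.ext (ContinuousMap.ext fun x => P.apply_zero x)
  have h1 {p q : BasedMap A.susp Z} (P : p.1.HomotopyRel q.1 {A.susp.pt}) : slice P 1 = q :=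
    Subtype.ext (ContinuousMap.ext fun x => P.apply_one x)
  refine homotopic_of_family ⟨fun q => (suspMul (slice F q.1) (slice G q.1)).1
    (suspMk q.2.1 q.2.2), ?_⟩ ?_ ?_ ?_
  · exact (Path.trans_continuous_family _ (hs F) _ (hs G)).comp
      (f := fun q : I × (A × I) => ((q.1, q.2.1), q.2.2)) (by fun_prop)
  · rintro s ⟨a, t⟩ hp
    change (suspMul (slice F s) (slice G s)).1 (suspMk a t) = Z.pt
    rw [suspMk_eq_pt hp, (suspMul (slice F s) (slice G s)).2]
  · intro a t
    change (suspMul (slice F 0) (slice G 0)).1 (suspMk a t) = _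
    rw [h0, h0]
  · intro a t
    change (suspMul (slice F 1) (slice G 1)).1 (suspMk a t) = _
    rw [h1, h1]

theorem suspInv_congr {f f' : BasedMap A.susp Z} (hf : f ≈ f') : suspInv f ≈ suspInv f' := by
  obtain ⟨F⟩ := hf
  refine homotopic_of_family ⟨fun q => F (q.1, suspMk q.2.1 (σ q.2.2)), ?_⟩ ?_ ?_ ?_
  · exact F.continuous.comp (continuous_fst.prodMk ((suspMk_quot (A := A)).continuous.comp
        (f := fun q : I × (A × I) => (q.2.1, σ q.2.2)) (by fun_prop)))
  · rintro s ⟨a, t⟩ hp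
    have : suspMk a (σ t) = A.susp.pt := suspMk_eq_pt (by
      rcases hp with h | h | h
      · exact Or.inl h
      · exact Or.inr (Or.inr (by simp_all))
      · exact Or.inr (Or.inl (by simp_all)))
    change F (s, suspMk a (σ t)) = _
    rw [this, F.eq_fst s rfl, f.2]
  · intro a t
    exact F.apply_zero _
  · intro a t
    exact F.apply_one _

/-- The group `[ΣA, Z]`, with the multiplication induced by the suspension coordinate. -/
noncomputable instance : Group (HomotopyClasses A.susp Z) :=
  letI : Mul (HomotopyClasses A.susp Z) :=
    ⟨Quotient.map₂ suspMul fun _ _ h _ _ h' => suspMul_congr h h'⟩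
  letI : Inv (HomotopyClasses A.susp Z) := ⟨Quotient.map suspInv fun _ _ h => suspInv_congr h⟩
  letI : One (HomotopyClasses A.susp Z) := ⟨Quotient.mk _ suspOne⟩
  Group.ofRightAxioms
    (by
      rintro ⟨f⟩ ⟨g⟩ ⟨h⟩
      refine Quotient.sound (homotopic_of_path_reparam
        (fun t => ⟨Path.Homotopy.transAssocReparamAux t,
          Path.Homotopy.transAssocReparamAux_mem_I t⟩) (by fun_prop)
        (Subtype.ext Path.Homotopy.transAssocReparamAux_zero)
        (Subtype.ext Path.Homotopy.transAssocReparamAux_one) fun a => ?_)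
      simp only [loopAt_mul]
      exact Path.Homotopy.trans_assoc_reparam _ _ _)
    (by
      rintro ⟨f⟩
      refine Quotient.sound (homotopic_of_path_reparam
        (fun t => ⟨Path.Homotopy.transReflReparamAux t,
          Path.Homotopy.transReflReparamAux_mem_I t⟩) (by fun_prop)
        (Subtype.ext Path.Homotopy.transReflReparamAux_zero)
        (Subtype.ext Path.Homotopy.transReflReparamAux_one) fun a => ?_)
      simp only [loopAt_mul, loopAt_one]
      exact Path.Homotopy.trans_refl_reparam _)
    (by
      rintro ⟨f⟩
      refine Quotient.sound (Setoid.symm (homotopic_of_reparam f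
        ⟨fun x => ⟨Path.Homotopy.reflTransSymmAux x, Path.Homotopy.reflTransSymmAux_mem_I x⟩,
          by fun_prop⟩ (fun s => Or.inl ?_) (fun s => Or.inl ?_) (fun a t => ?_) (fun a t => ?_)))
      · exact Subtype.ext (by simp [Path.Homotopy.reflTransSymmAux])
      · exact Subtype.ext (by norm_num [Path.Homotopy.reflTransSymmAux])
      · exact ((Path.Homotopy.reflTransSymm (loopAt f a)).apply_zero t).symm
      · exact ((Path.Homotopy.reflTransSymm (loopAt f a)).apply_one t).symm)

end Suspension

/-- The homomorphism `[ΣA, Z] → [ΣA, W]` given by composition with a based map `Z → W`. -/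
noncomputable def postcomp (A : BasedSpace.{u}) {Z : BasedSpace.{v}} {W : BasedSpace.{w}}
    (φ : BasedMap Z W) : HomotopyClasses A.susp Z →* HomotopyClasses A.susp W :=
  MonoidHom.mk' (Quotient.map φ.comp fun _ _ h =>
      ContinuousMap.HomotopicRel.comp_continuousMap h φ.1) (by
    rintro ⟨f⟩ ⟨g⟩
    refine congrArg (Quotient.mk _) (Subtype.ext (ContinuousMap.ext ?_))
    rintro ⟨a, t⟩
    exact DFunLike.congr_fun (Path.map_trans (loopAt f a) (loopAt g a) φ.1.continuous) t)

/-- The generalized Gottlieb group `𝒢(ΣA, Z)`: the image of `ω_* : [ΣA, aut₁ Z] → [ΣA, Z]`. -/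
noncomputable def genGottlieb (A : BasedSpace.{u}) (Z : BasedSpace.{v}) :
    Subgroup (HomotopyClasses A.susp Z) :=
  (postcomp A Z.omega).range

/-- The homomorphism of homotopy groups induced by a based map. -/
noncomputable def piMap (n : ℕ) [NeZero n] {Z : BasedSpace.{v}} {W : BasedSpace.{w}}
    (φ : BasedMap Z W) : π_ n Z Z.pt →* π_ n W W.pt :=
  MonoidHom.mk' (Quotient.map (fun p => ⟨φ.1.comp p.1, fun y hy => by
      rw [ContinuousMap.comp_apply, p.2 y hy, φ.2]⟩) fun _ _ h =>
      ContinuousMap.HomotopicRel.comp_continuousMap h φ.1) (by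
    rintro ⟨p⟩ ⟨q⟩
    refine (congrArg _ (HomotopyGroup.mul_spec (i := 0))).trans
      (Eq.trans ?_ (HomotopyGroup.mul_spec (i := 0)).symm)
    refine congrArg (Quotient.mk _) (GenLoop.ext _ _ fun y => ?_)
    exact apply_ite φ.1 _ _ _)

/-- The Gottlieb group `G_n(Z)`, `n ≥ 1`: the image of `ω_# : π_n(aut₁ Z) → π_n(Z)`. -/
noncomputable def gottlieb (n : ℕ) [NeZero n] (Z : BasedSpace.{v}) : Subgroup (π_ n Z Z.pt) :=
  (piMap n Z.omega).range

end BasedSpace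

/-! Write M(Z) for `X.mapNull Z`. A self-map θ of M(Y) restricted to constants gives x ↦ (y ↦
θ(const y)(x)), and φ in M(aut₁ Y) acts on M(Y) by f ↦ (x ↦ φ(x)(f x)). Through these two maps
(`autToMap`, `mapToAut`) the evaluation ω of M(Y) and the map M(ω) : M(aut₁ Y) → M(Y) factor through
each other, so the Gottlieb group of M(Y) is the image of M(ω) (`genGottlieb_mapNull`,
`gottlieb_mapNull`).

Evaluation at the base point, M(Z) → Z, is split by the constants, and the kernel it induces on [ΣA,
-] is [Σ(A ∧ X), Z] by adjunction (`smashHom`); on π_{n+1} it is [Σⁿ⁺¹X, Z] (`cubeHom`). The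
adjunction is between free and based families on X, and well-pointedness of X closes the gap
(`WellPointed.homotopicRel_const`, `WellPointed.exists_homotopicRel`).

All of this is natural in Z, so it may be compared along ω : aut₁ Y → Y. For Z = Y the splitting is
a priori only semidirect. But M(aut₁ Y) has a strictly unital multiplication, so the groups over it
are commutative, and the image of M(ω) is a direct product (`nonempty_range_mulEquiv_prod`). -/

namespace BasedSpace

/-! ### Quotients collapsing a subset to the base point -/

section Collapse

/-- The map `q` exhibits the based space `V` as the quotient `T / S`, where `S` is nonempty. -/
structure IsCollapse {T : Type*} [TopologicalSpace T] (S : Set T) {V : BasedSpace.{v}}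
    (q : T → V) : Prop where
  isQuotientMap : Topology.IsQuotientMap q
  eq_pt_iff : ∀ p, q p = V.pt ↔ p ∈ S
  eq_or_mem : ∀ p p', q p = q p' → p = p' ∨ p ∈ S

/-- A set is open exactly when its membership predicate is continuous into `Prop`, and continuity
descends along q × id because K is locally compact. -/
theorem _root_.Topology.IsQuotientMap.prodMap_id {T V K : Type*} [TopologicalSpace T]
    [TopologicalSpace V] [TopologicalSpace K] [LocallyCompactSpace K] {q : T → V}
    (hq : Topology.IsQuotientMap q) :
    Topology.IsQuotientMap (Prod.map q id : T × K → V × K) := by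
  refine ⟨Topology.isCoinducing_iff.2 fun s => ⟨fun hs => ?_, fun hs =>
    hs.preimage (hq.continuous.prodMap continuous_id)⟩, hq.surjective.prodMap Function.surjective_id⟩
  rw [isOpen_iff_continuous_mem] at hs ⊢
  exact hq.continuous_lift_prod_left hs

theorem isCollapse_mk {T : Type u} [TopologicalSpace T] {S : Set T} {p : T} (hp : p ∈ S) :
    IsCollapse S (V := collapse S p) (Quotient.mk (collapseSetoid S)) where
  isQuotientMap := isQuotientMap_quot_mk
  eq_pt_iff _ := by
    refine ⟨fun h => ?_, fun h => Quotient.sound (s := collapseSetoid S) (Or.inr ⟨h, hp⟩)⟩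
    rcases Quotient.exact (s := collapseSetoid S) h with rfl | h
    exacts [hp, h.1]
  eq_or_mem _ _ h := (Quotient.exact (s := collapseSetoid S) h).imp_right And.left

variable {T T' : Type*} [TopologicalSpace T] [TopologicalSpace T'] {S : Set T} {V : BasedSpace.{v}}
  {q : T → V}

theorem IsCollapse.comp_homeomorph (hq : IsCollapse S q) (e : T' ≃ₜ T) :
    IsCollapse (e ⁻¹' S) (q ∘ e) where
  isQuotientMap := hq.isQuotientMap.comp e.isQuotientMap
  eq_pt_iff p := hq.eq_pt_iff (e p)
  eq_or_mem _ _ h := (hq.eq_or_mem _ _ h).imp_left fun h => e.injective h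

theorem IsCollapse.susp (hq : IsCollapse S q) :
    IsCollapse {p : T × I | p.1 ∈ S ∨ p.2 = 0 ∨ p.2 = 1}
      (fun p => (suspMk (q p.1) p.2 : V.susp)) := by
  have h := isCollapse_mk (S := V.suspSet) (p := (V.pt, 0)) (Or.inl rfl)
  refine ⟨h.isQuotientMap.comp (hq.isQuotientMap.prodMap_id (K := I)), fun p => ?_,
    fun p p' e => ?_⟩
  · exact (h.eq_pt_iff (q p.1, p.2)).trans (or_congr_left (hq.eq_pt_iff p.1))
  · rcases h.eq_or_mem _ _ e with e | e | e
    · rcases hq.eq_or_mem _ _ (Prod.mk.inj e).1 with e' | e'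
      · exact Or.inl (Prod.ext e' (Prod.mk.inj e).2)
      · exact Or.inr (Or.inl e')
    · exact Or.inr (Or.inl ((hq.eq_pt_iff _).1 e))
    · exact Or.inr (Or.inr e)

theorem isCollapse_id (V : BasedSpace.{v}) : IsCollapse {V.pt} (id : V → V) :=
  ⟨.id, fun _ => Iff.rfl, fun _ _ => Or.inl⟩

variable {Z : BasedSpace.{w}}

theorem IsCollapse.exists_lift (hq : IsCollapse S q) (F : C(T, Z)) (hF : ∀ p ∈ S, F p = Z.pt) :
    ∃ f : BasedMap V Z, ∀ p, f.1 (q p) = F p := by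
  have hc : ∀ p p', q p = q p' → F p = F p' := fun p p' h => by
    rcases hq.eq_or_mem _ _ h with rfl | h'
    · rfl
    · rw [hF p h', hF p' ((hq.eq_pt_iff p').1 (h ▸ (hq.eq_pt_iff p).2 h'))]
  let q' : C(T, V) := ⟨q, hq.isQuotientMap.continuous⟩
  have hq' : Topology.IsQuotientMap q' := hq.isQuotientMap
  have key : ∀ p, hq'.lift F (fun p p' h => hc p p' h) (q p) = F p := fun p =>
    DFunLike.congr_fun (hq'.lift_comp F fun p p' h => hc p p' h) p
  obtain ⟨p, hp⟩ := hq.isQuotientMap.surjective V.pt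
  refine ⟨⟨hq'.lift F fun p p' h => hc p p' h, ?_⟩, key⟩
  rw [← hp, key, hF p ((hq.eq_pt_iff p).1 hp)]

theorem IsCollapse.apply_eq_pt (hq : IsCollapse S q) (f : BasedMap V Z) {p : T} (hp : p ∈ S) :
    f.1 (q p) = Z.pt := by
  rw [(hq.eq_pt_iff p).2 hp, f.2]

/-- A homotopy upstairs descends one time slice at a time; the slices fit together continuously
since I is locally compact. -/
theorem IsCollapse.equiv_iff (hq : IsCollapse S q) {f g : BasedMap V Z} :
    f ≈ g ↔ (f.1.comp ⟨q, hq.isQuotientMap.continuous⟩).HomotopicRel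
      (g.1.comp ⟨q, hq.isQuotientMap.continuous⟩) S := by
  have hc := hq.isQuotientMap.continuous
  constructor
  · rintro ⟨H⟩
    refine ⟨⟨⟨⟨fun x => H (x.1, q x.2), by fun_prop⟩, fun x => H.apply_zero _,
      fun x => H.apply_one _⟩, fun s p hp => ?_⟩⟩
    exact H.eq_fst s ((hq.eq_pt_iff p).2 hp)
  · rintro ⟨H⟩
    obtain ⟨p₀, hp₀⟩ := hq.isQuotientMap.surjective V.pt
    have hp₀' := (hq.eq_pt_iff p₀).1 hp₀
    choose K hK using fun s : I => hq.exists_lift (Z := Z)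
      (H.toContinuousMap.comp ⟨fun p => (s, p), by fun_prop⟩)
      (fun p hp => (H.eq_fst s hp).trans (hq.apply_eq_pt f hp))
    have hK' : ∀ s p, (K s).1 (q p) = H (s, p) := hK
    refine ⟨⟨⟨⟨fun x => (K x.1).1 x.2,
      hq.isQuotientMap.continuous_lift_prod_right (g := fun x : I × V => (K x.1).1 x.2) ?_⟩,
        fun x => ?_, fun x => ?_⟩, fun s x hx => ?_⟩⟩
    · simp only [hK']
      exact H.continuous
    · obtain ⟨p, rfl⟩ := hq.isQuotientMap.surjective x
      exact (hK' 0 p).trans (H.apply_zero p)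
    · obtain ⟨p, rfl⟩ := hq.isQuotientMap.surjective x
      exact (hK' 1 p).trans (H.apply_one p)
    · obtain rfl : x = V.pt := hx
      exact (K s).2.trans f.2.symm

end Collapse

/-! ### Homotopy extension and passage from free to based null homotopies -/

section Deformation

variable {X : BasedSpace.{u}}

theorem WellPointed.exists_retraction (hX : X.WellPointed) :
    ∃ R : C(X × I, X × I), (∀ x, R (x, 0) = (x, 0)) ∧ (∀ t, R (X.pt, t) = (X.pt, t)) ∧
      ∀ p, (R p).1 = X.pt ∨ (R p).2 = 0 := by
  obtain ⟨H, h0, h1⟩ := hX {p : X × I // p.1 = X.pt ∨ p.2 = 0}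
    ⟨fun x => ⟨(x, 0), Or.inr rfl⟩, by fun_prop⟩ ⟨fun t => ⟨(X.pt, t), Or.inl rfl⟩, by fun_prop⟩ rfl
  exact ⟨⟨fun p => (H p).1, by fun_prop⟩, fun x => congrArg Subtype.val (h0 x),
    fun t => congrArg Subtype.val (h1 t), fun p => (H p).2⟩

variable {B W : Type*} [TopologicalSpace B] [TopologicalSpace W]

/-- The homotopy extension property of the base point, with parameters. -/
theorem WellPointed.exists_deformation [T1Space X] (hX : X.WellPointed) (F : C(B × X, W))
    (K : C(I × B, W)) (h : ∀ b, K (0, b) = F (b, X.pt)) :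
    ∃ Φ : C(I × (B × X), W), (∀ p, Φ (0, p) = F p) ∧ (∀ u b, Φ (u, (b, X.pt)) = K (u, b)) ∧
      ∀ b y, (∀ u, K (u, b) = y) → (∀ x, F (b, x) = y) → ∀ u x, Φ (u, (b, x)) = y := by
  classical
  obtain ⟨R, hR0, hRt, hR⟩ := hX.exists_retraction
  let r : I × (B × X) → X × I := fun p => R (p.2.2, p.1)
  have hr : Continuous r := by fun_prop
  -- The retraction sends (x, u) into pt × I, where K applies, or into X × 0, where F applies. Both
  -- pieces are closed (the first because X is T1) and they agree at (pt, 0), so φ is continuous for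
  -- an arbitrary parameter space B.
  let φ : I × (B × X) → W := fun p =>
    if (r p).1 = X.pt then K ((r p).2, p.2.1) else F (p.2.1, (r p).1)
  have e1 : ∀ p, (r p).1 = X.pt → φ p = K ((r p).2, p.2.1) := fun p hp => if_pos hp
  have e2 : ∀ p, (r p).2 = 0 → φ p = F (p.2.1, (r p).1) := fun p hp => by
    by_cases hp' : (r p).1 = X.pt
    · rw [e1 p hp', hp, hp', h]
    · exact if_neg hp'
  have c1 : IsClosed {p | (r p).1 = X.pt} :=
    isClosed_singleton.preimage (continuous_fst.comp hr)
  have c2 : IsClosed {p | (r p).2 = 0} :=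
    isClosed_singleton.preimage (continuous_snd.comp hr)
  have hφ : Continuous φ := by
    rw [← continuousOn_univ,
      ← show {p | (r p).1 = X.pt} ∪ {p | (r p).2 = 0} = Set.univ from
        Set.eq_univ_of_forall fun p => hR _]
    refine ContinuousOn.union_of_isClosed ?_ ?_ c1 c2
    · refine ContinuousOn.congr (Continuous.continuousOn ?_) e1
      fun_prop
    · refine ContinuousOn.congr (Continuous.continuousOn ?_) e2
      fun_prop
  refine ⟨⟨φ, hφ⟩, ?_, ?_, ?_⟩
  · rintro ⟨b, x⟩
    have := e2 (0, (b, x)) (by simp [r, hR0])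
    simpa [r, hR0] using this
  · intro u b
    have := e1 (u, (b, X.pt)) (by simp [r, hRt])
    simpa [r, hRt] using this
  · intro b y hK hF u x
    rcases hR (x, u) with hp | hp
    · exact (e1 (u, (b, x)) hp).trans (hK _)
    · exact (e2 (u, (b, x)) hp).trans (hF _)

variable {E : Type*} [TopologicalSpace E]

/-- A null homotopy of a family of based maps on `X` can be made based. -/
theorem WellPointed.homotopicRel_const [T1Space X] (hX : X.WellPointed) {S : Set E} {y : W}
    {f : C(E × X, W)} (hf : ∀ e, f (e, X.pt) = y)
    (h : f.HomotopicRel (.const _ y) {p | p.1 ∈ S}) :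
    f.HomotopicRel (.const _ y) {p | p.1 ∈ S ∨ p.2 = X.pt} := by
  obtain ⟨H⟩ := h
  have hS : ∀ s p, p.1 ∈ S → H (s, p) = y := fun s p hp => H.eq_snd s hp
  -- The tent function 0 → 1 → 0. In F below, the first half runs H on all of X and the second half
  -- runs back only the track of the base point; they match at s = 1/2, where H is constant.
  let c : C(I, I) := ⟨fun s => ⟨min (2 * s) (2 - 2 * s), by
    have := s.2.1; have := s.2.2
    refine ⟨le_min ?_ ?_, ?_⟩
    · linarith
    · linarith
    · rcases le_total (s : ℝ) (1 / 2) with h | h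
      · exact (min_le_left _ _).trans (by linarith)
      · exact (min_le_right _ _).trans (by linarith)⟩, by fun_prop⟩
  have c0 : c 0 = 0 := Subtype.ext (by simp [c])
  have c1 : c 1 = 0 := Subtype.ext (by simp [c])
  have ch : ∀ s : I, (s : ℝ) = 1 / 2 → c s = 1 := fun s hs => Subtype.ext (by simp [c, hs]; norm_num)
  let F : C((I × E) × X, W) := ⟨fun p => if (p.1.1 : ℝ) ≤ 1 / 2 then H (c p.1.1, (p.1.2, p.2))
      else H (c p.1.1, (p.1.2, X.pt)), by
    refine continuous_if_le (by fun_prop) (by fun_prop) (by fun_prop) (by fun_prop) ?_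
    intro p hp
    simp [ch _ hp]⟩
  have hF : ∀ s e x, F ((s, e), x) = if (s : ℝ) ≤ 1 / 2 then H (c s, (e, x))
    else H (c s, (e, X.pt)) := fun _ _ _ => rfl
  -- At the base point F traces a path followed by its reverse; scaling c to zero contracts this
  -- loop. Extending the contraction over X makes the stage u = 1 constant at the base point.
  let K : C(I × (I × E), W) := ⟨fun p => H (σ p.1 * c p.2.1, (p.2.2, X.pt)), by fun_prop⟩
  have hK : ∀ u s e, K (u, (s, e)) = H (σ u * c s, (e, X.pt)) := fun _ _ _ => rfl
  have H0 : ∀ e, H (0, (e, X.pt)) = y := fun e => (H.apply_zero _).trans (hf e)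
  obtain ⟨Φ, h0, h1, h2⟩ := hX.exists_deformation F K (by
    rintro ⟨s, e⟩
    simp [hK, hF])
  have hΦS : ∀ u s e, e ∈ S → ∀ x, Φ (u, ((s, e), x)) = y := fun u s e he x =>
    h2 (s, e) y (fun u => by rw [hK, hS _ _ he])
      (fun x => by rw [hF, hS _ _ he, hS _ _ he, ite_self]) u x
  let g : C(E × X, W) := ⟨fun p => Φ (1, ((0, p.1), p.2)), by fun_prop⟩
  -- The deformation at s = 0 is itself based, since c 0 = 0 keeps K at y there. Then stage u = 1,
  -- run in s, is a based homotopy from g to the constant map.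
  have hfg : f.HomotopicRel g {p | p.1 ∈ S ∨ p.2 = X.pt} := by
    refine ⟨⟨⟨⟨fun p => Φ (p.1, ((0, p.2.1), p.2.2)), by fun_prop⟩, fun p => ?_, fun p => rfl⟩, ?_⟩⟩
    · exact (h0 _).trans (by simp [hF, c0])
    · rintro u ⟨e, x⟩ (he | hx)
      · exact (hΦS u 0 e he x).trans ((H.eq_fst 0 he).symm.trans (hS _ _ he)).symm
      · obtain rfl : x = X.pt := hx
        refine (h1 u (0, e)).trans ?_
        rw [hK, c0, mul_zero, H0, hf]
  refine hfg.trans ⟨⟨⟨⟨fun p => Φ (1, ((p.1, p.2.1), p.2.2)), by fun_prop⟩, fun p => rfl,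
    fun p => ?_⟩, ?_⟩⟩
  · refine h2 (1, p.1) y (fun u => ?_) (fun x => ?_) 1 p.2
    · rw [hK, c1, mul_zero, H0]
    · rw [hF, c1, H0, if_neg (by norm_num)]
  · rintro s ⟨e, x⟩ (he | hx)
    · exact (hΦS 1 s e he x).trans (hΦS 1 0 e he x).symm
    · obtain rfl : x = X.pt := hx
      have : ∀ s, Φ (1, ((s, e), X.pt)) = y := fun s => by
        rw [h1, hK]
        simpa using H0 e
      exact (this s).trans (this 0).symm

/-- A family of maps on `X` whose values at the base point form a null homotopic map can be
deformed to a family of based maps. -/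
theorem WellPointed.exists_homotopicRel [T1Space X] (hX : X.WellPointed) {S : Set E} {y : W}
    {F : C(E × X, W)} (hF : ∀ p, p.1 ∈ S → F p = y)
    (h : (F.comp (.prodMk (.id E) (.const E X.pt))).HomotopicRel (.const _ y) S) :
    ∃ G : C(E × X, W), (∀ p, p.1 ∈ S ∨ p.2 = X.pt → G p = y) ∧
      F.HomotopicRel G {p | p.1 ∈ S} := by
  obtain ⟨K⟩ := h
  obtain ⟨Φ, h0, h1, h2⟩ := hX.exists_deformation F K.toContinuousMap (fun b => K.apply_zero b)
  have hS : ∀ u p, p.1 ∈ S → Φ (u, p) = y := fun u p hp =>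
    h2 p.1 y (fun u => K.eq_snd u hp) (fun x => hF (p.1, x) hp) u p.2
  refine ⟨⟨fun p => Φ (1, p), by fun_prop⟩, ?_, ⟨⟨⟨Φ, h0, fun p => rfl⟩, fun u p hp => ?_⟩⟩⟩
  · rintro ⟨e, x⟩ (he | hx)
    · exact hS 1 _ he
    · obtain rfl : x = X.pt := hx
      exact (h1 1 e).trans (K.apply_one e)
  · exact (hS u p hp).trans (hF p hp).symm

end Deformation

/-! ### The null component of the mapping space -/

section MapNull

/-- The map `map(X, Z; 0) → map(X, W; 0)` given by composition with a based map `Z → W`. -/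
def mapNullMap (X : BasedSpace.{u}) {Z : BasedSpace.{v}} {W : BasedSpace.{w}} (φ : BasedMap Z W) :
    BasedMap (X.mapNull Z) (X.mapNull W) :=
  ⟨⟨fun f => ⟨φ.1.comp f.1, by
      have h := (ContinuousMap.Homotopic.refl φ.1).comp f.2
      rwa [ContinuousMap.comp_const, φ.2] at h⟩,
    ((ContinuousMap.continuous_postcomp φ.1).comp continuous_subtype_val).subtype_mk _⟩,
    Subtype.ext (ContinuousMap.ext fun _ => φ.2)⟩

/-- The evaluation map `map(X, Z; 0) → Z` at a point. -/
def evalMap (X : BasedSpace.{u}) (Z : BasedSpace.{v}) (x : X) : BasedMap (X.mapNull Z) Z :=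
  ⟨⟨fun f => f.1 x, (continuous_eval_const x).comp continuous_subtype_val⟩, rfl⟩

/-- The inclusion `Z → map(X, Z; 0)` of the constant maps. -/
def constMap (X : BasedSpace.{u}) (Z : BasedSpace.{v}) [PathConnectedSpace Z] :
    BasedMap Z (X.mapNull Z) :=
  ⟨⟨fun z => ⟨.const X z, by
      obtain ⟨γ⟩ := PathConnectedSpace.joined z Z.pt
      exact ⟨⟨⟨fun p => γ p.1, by fun_prop⟩, fun _ => γ.source, fun _ => γ.target⟩⟩⟩,
    ContinuousMap.continuous_const'.subtype_mk _⟩, rfl⟩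

/-- The path is t ↦ H(t, ·); it stays in the homotopy class because the rest of H, reparametrized by
p ⊔ t, joins each stage to g. -/
theorem joined_subtype_homotopic {T Z : Type*} [TopologicalSpace T] [TopologicalSpace Z]
    {g : C(T, Z)} (f : {f : C(T, Z) // f.Homotopic g}) : Joined f ⟨g, .refl g⟩ := by
  obtain ⟨f, ⟨H⟩⟩ := f
  refine ⟨⟨⟨fun t => ⟨H.curry t, ⟨⟨⟨fun p => H (p.1 ⊔ t, p.2), by fun_prop⟩, fun x => ?_,
    fun x => ?_⟩⟩⟩, H.curry.continuous.subtype_mk _⟩, Subtype.ext ?_, Subtype.ext ?_⟩⟩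
  · change H (0 ⊔ t, x) = H (t, x)
    rw [sup_eq_right.2 (show 0 ≤ t from t.2.1)]
  · change H (1 ⊔ t, x) = g x
    rw [sup_eq_left.2 (show t ≤ 1 from t.2.2), H.apply_one]
  · exact H.curry_zero
  · exact H.curry_one

theorem homotopic_of_joined {D T Z : Type*} [TopologicalSpace D] [TopologicalSpace T]
    [TopologicalSpace Z] (G : C(D × T, Z)) {d d' : D} (h : Joined d d') :
    (G.curry d).Homotopic (G.curry d') := by
  obtain ⟨γ⟩ := h
  exact ⟨⟨⟨fun p => G (γ p.1, p.2), by fun_prop⟩,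
    fun x => congrArg (fun d => G (d, x)) γ.source, fun x => congrArg (fun d => G (d, x)) γ.target⟩⟩

theorem joined_mapNull_pt {X : BasedSpace.{u}} {Z : BasedSpace.{v}} (f : X.mapNull Z) :
    Joined f (X.mapNull Z).pt :=
  joined_subtype_homotopic f

theorem joined_autOne_pt {Z : BasedSpace.{v}} (f : Z.autOne) : Joined f Z.autOne.pt :=
  joined_subtype_homotopic f

/-- Lets `constMap`, hence the splitting, be used with aut₁ Y as target. -/
instance (Y : BasedSpace.{v}) : PathConnectedSpace Y.autOne :=
  ⟨⟨Y.autOne.pt⟩, fun f g => (joined_autOne_pt f).trans (joined_autOne_pt g).symm⟩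

end MapNull

/-! ### Comparing aut₁ map(X, Y; 0) with map(X, aut₁ Y; 0) -/

section Aut

variable (X : BasedSpace.{u}) (Y : BasedSpace.{v}) [LocallyCompactSpace X] [LocallyCompactSpace Y]

/-- θ is first restricted to the constants, so that the evaluations take place on Y and X, which are
locally compact; map(X, Y; 0) need not be. -/
theorem continuous_adjointAut [PathConnectedSpace Y] :
    Continuous fun p : (C(X.mapNull Y, X.mapNull Y) × X) × Y =>
      (p.1.1 ((constMap X Y).1 p.2)).1 p.1.2 := by
  have h : Continuous fun p : (C(X.mapNull Y, X.mapNull Y) × X) × Y =>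
      (p.1.1.comp (constMap X Y).1) p.2 :=
    ((ContinuousMap.continuous_precomp (constMap X Y).1).comp
      (continuous_fst.comp continuous_fst)).eval continuous_snd
  exact (continuous_subtype_val.comp h).eval (continuous_snd.comp continuous_fst)

/-- The map `θ ↦ (x ↦ (y ↦ θ (const y) x))`. -/
def adjointAut [PathConnectedSpace Y] : C(C(X.mapNull Y, X.mapNull Y), C(X, C(Y, Y))) :=
  ContinuousMap.curry (ContinuousMap.curry ⟨_, continuous_adjointAut X Y⟩)

theorem adjointAut_homotopic_id [PathConnectedSpace Y] (θ : (X.mapNull Y).autOne) (x : X) :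
    (adjointAut X Y θ.1 x).Homotopic (.id Y) := by
  obtain ⟨H⟩ := θ.2
  refine ⟨⟨⟨fun p => (H (p.1, (constMap X Y).1 p.2)).1 x, ?_⟩, fun y => ?_, fun y => ?_⟩⟩
  · exact (evalMap X Y x).1.continuous.comp (by fun_prop)
  · exact congrArg (fun f : X.mapNull Y => f.1 x) (H.apply_zero _)
  · exact congrArg (fun f : X.mapNull Y => f.1 x) (H.apply_one _)

/-- The based map `aut₁ map(X, Y; 0) → map(X, aut₁ Y; 0)` adjoint to
`(θ, x, y) ↦ θ (const y) x`. -/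
def autToMap [PathConnectedSpace Y] : BasedMap (X.mapNull Y).autOne (X.mapNull Y.autOne) := by
  have hc : Continuous fun p : (X.mapNull Y).autOne × X =>
      (⟨adjointAut X Y p.1.1 p.2, adjointAut_homotopic_id X Y p.1 p.2⟩ : Y.autOne) := by
    refine Continuous.subtype_mk ?_ _
    exact ((adjointAut X Y).continuous.comp (continuous_subtype_val.comp continuous_fst)).eval
      continuous_snd
  exact ⟨⟨fun θ => ⟨ContinuousMap.curry ⟨_, hc⟩ θ, homotopic_of_joined ⟨_, hc⟩ (joined_autOne_pt θ)⟩,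
    by exact (ContinuousMap.curry ⟨_, hc⟩).continuous.subtype_mk _⟩, rfl⟩

/-- The based map `map(X, aut₁ Y; 0) → aut₁ map(X, Y; 0)` adjoint to
`(φ, f, x) ↦ φ x (f x)`. -/
def mapToAut : BasedMap (X.mapNull Y.autOne) (X.mapNull Y).autOne := by
  have hc : Continuous fun p : (C(X, Y.autOne) × X.mapNull Y) × X => (p.1.1 p.2).1 (p.1.2.1 p.2) :=
    (continuous_subtype_val.comp ((continuous_fst.comp continuous_fst).eval continuous_snd)).eval
      ((continuous_subtype_val.comp (continuous_snd.comp continuous_fst)).eval continuous_snd)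
  -- A null homotopy of φ deforms x ↦ φ x (f x) to f, which is itself null homotopic.
  have mem : ∀ φ : C(X, Y.autOne), φ.Homotopic (.const X Y.autOne.pt) → ∀ f : X.mapNull Y,
      (ContinuousMap.curry ⟨_, hc⟩ (φ, f)).Homotopic (.const X Y.pt) := by
    rintro φ ⟨H⟩ f
    refine .trans ⟨⟨⟨fun p => (H p).1 (f.1 p.2), ?_⟩, fun x => ?_, fun x => ?_⟩⟩ f.2
    · exact (continuous_subtype_val.comp H.continuous).eval (by fun_prop)
    · exact congrArg (fun θ : Y.autOne => θ.1 (f.1 x)) (H.apply_zero x)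
    · exact congrArg (fun θ : Y.autOne => θ.1 (f.1 x)) (H.apply_one x)
  have hc' : Continuous fun p : X.mapNull Y.autOne × X.mapNull Y =>
      (⟨ContinuousMap.curry ⟨_, hc⟩ (p.1.1, p.2), mem p.1.1 p.1.2 p.2⟩ : X.mapNull Y) := by
    refine Continuous.subtype_mk ?_ _
    exact (ContinuousMap.continuous _).comp
      ((continuous_subtype_val.comp continuous_fst).prodMk continuous_snd)
  exact ⟨⟨fun φ => ⟨ContinuousMap.curry ⟨_, hc'⟩ φ,
    homotopic_of_joined ⟨_, hc'⟩ (joined_mapNull_pt φ)⟩,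
    by exact (ContinuousMap.curry ⟨_, hc'⟩).continuous.subtype_mk _⟩, rfl⟩

theorem omega_comp_mapToAut :
    (X.mapNull Y).omega.comp (mapToAut X Y) = mapNullMap X Y.omega := rfl

theorem mapNullMap_comp_autToMap [PathConnectedSpace Y] :
    (mapNullMap X Y.omega).comp (autToMap X Y) = (X.mapNull Y).omega := rfl

end Aut

/-! ### Strictly unital multiplications -/

section Multiplication

/-- The product of two based spaces. -/
def prod (Z : BasedSpace.{u}) (W : BasedSpace.{v}) : BasedSpace.{max u v} where
  carrier := Z × W
  pt := (Z.pt, W.pt)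

/-- A continuous multiplication for which the base point is a strict two-sided unit. -/
structure UnitalMul (M : BasedSpace.{u}) where
  mul : BasedMap (M.prod M) M
  pt_mul : ∀ x, mul.1 (M.pt, x) = x
  mul_pt : ∀ x, mul.1 (x, M.pt) = x

/-- Composition of maps. -/
def autOneMul (Y : BasedSpace.{v}) [LocallyCompactSpace Y] : UnitalMul Y.autOne where
  mul := ⟨⟨fun p => ⟨p.1.1.comp p.2.1, p.1.2.comp p.2.2⟩, Continuous.subtype_mk
    (ContinuousMap.continuous_comp'.comp ((continuous_subtype_val.comp continuous_snd).prodMk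
      (continuous_subtype_val.comp continuous_fst))) _⟩, rfl⟩
  pt_mul _ := rfl
  mul_pt _ := rfl

/-- Pointwise multiplication of maps. -/
def UnitalMul.mapNull (X : BasedSpace.{u}) [LocallyCompactSpace X] {M : BasedSpace.{v}}
    (μ : UnitalMul M) : UnitalMul (X.mapNull M) where
  mul := ⟨⟨fun p => ⟨μ.mul.1.comp (p.1.1.prodMk p.2.1), by
      have h := (ContinuousMap.Homotopic.refl μ.mul.1).comp (p.1.2.prodMk p.2.2)
      have e : μ.mul.1.comp ((ContinuousMap.const X M.pt).prodMk (.const X M.pt)) =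
        .const X M.pt := ContinuousMap.ext fun _ => μ.pt_mul _
      rwa [e] at h⟩, by
      refine Continuous.subtype_mk ((ContinuousMap.continuous_postcomp μ.mul.1).comp
        (ContinuousMap.continuous_of_continuous_uncurry _ ?_)) _
      exact ((continuous_subtype_val.comp (continuous_fst.comp continuous_fst)).eval
        continuous_snd).prodMk ((continuous_subtype_val.comp
          (continuous_snd.comp continuous_fst)).eval continuous_snd)⟩,
    Subtype.ext (ContinuousMap.ext fun _ => μ.pt_mul _)⟩
  pt_mul f := Subtype.ext (ContinuousMap.ext fun _ => μ.pt_mul _)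
  mul_pt f := Subtype.ext (ContinuousMap.ext fun _ => μ.mul_pt _)

end Multiplication

/-! ### Adjunction between families on X and maps on a quotient of E × X -/

section Adjoint

theorem joined_zero (s : I) : Joined s 0 :=
  ⟨⟨⟨fun t => s * σ t, by fun_prop⟩, by simp, by simp⟩⟩

variable {X : BasedSpace.{u}} {W : BasedSpace.{w}} {E : Type*} [TopologicalSpace E] {S : Set E}

theorem mapNull_homotopicRel {F G : C(E, X.mapNull W)} {F' G' : C(E × X, W)}
    (hF : ∀ e x, (F e).1 x = F' (e, x)) (hG : ∀ e x, (G e).1 x = G' (e, x))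
    (h : F'.HomotopicRel G' {p | p.1 ∈ S}) : F.HomotopicRel G S := by
  obtain ⟨H⟩ := h
  let H' : C((I × E) × X, W) := ⟨fun p => H (p.1.1, (p.1.2, p.2)), by fun_prop⟩
  have h0 : ∀ e, H'.curry (0, e) = (F e).1 := fun e =>
    ContinuousMap.ext fun x => (H.apply_zero (e, x)).trans (hF e x).symm
  have h1 : ∀ e, H'.curry (1, e) = (G e).1 := fun e =>
    ContinuousMap.ext fun x => (H.apply_one (e, x)).trans (hG e x).symm
  -- Sliding s to 0 joins every stage to a value of F, so the homotopy never leaves the null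
  -- component.
  have mem : ∀ d, (H'.curry d).Homotopic (.const X W.pt) := by
    rintro ⟨s, e⟩
    refine (homotopic_of_joined H' (d' := (0, e)) ?_).trans ((h0 e).symm ▸ (F e).2)
    exact (joined_zero s).map (f := fun s : I => (s, e)) (by fun_prop)
  refine ⟨⟨⟨⟨fun d => ⟨H'.curry d, mem d⟩, by exact H'.curry.continuous.subtype_mk _⟩,
    fun e => Subtype.ext (h0 e), fun e => Subtype.ext (h1 e)⟩, fun s e he => Subtype.ext ?_⟩⟩
  exact ContinuousMap.ext fun x => (H.eq_fst s (x := (e, x)) he).trans (hF e x).symm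

variable {V : BasedSpace.{v}} {q : E × X → V}

/-- The family of maps on `X` that corresponds to a based map on the quotient `V` of `E × X`. -/
def adjoint (hq : IsCollapse {p : E × X | p.1 ∈ S ∨ p.2 = X.pt} q)
    (hS : ∀ e, ∃ e' ∈ S, Joined e e') (g : BasedMap V W) : C(E, X.mapNull W) :=
  let G : C(E × X, W) := g.1.comp ⟨q, hq.isQuotientMap.continuous⟩
  ⟨fun e => ⟨G.curry e, by
      obtain ⟨e', he', h⟩ := hS e
      have := homotopic_of_joined G h
      rwa [show G.curry e' = .const X W.pt from
        ContinuousMap.ext fun x => hq.apply_eq_pt g (Or.inl he')] at this⟩,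
    by exact G.curry.continuous.subtype_mk _⟩

variable (hq : IsCollapse {p : E × X | p.1 ∈ S ∨ p.2 = X.pt} q)
  (hS : ∀ e, ∃ e' ∈ S, Joined e e')

theorem adjoint_of_mem (g : BasedMap V W) {e : E} (he : e ∈ S) :
    adjoint hq hS g e = (X.mapNull W).pt :=
  Subtype.ext (ContinuousMap.ext fun _ => hq.apply_eq_pt g (Or.inl he))

theorem adjoint_congr {g g' : BasedMap V W} (h : g ≈ g') :
    (adjoint hq hS g).HomotopicRel (adjoint hq hS g') S := by
  obtain ⟨H⟩ := hq.equiv_iff.1 h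
  exact mapNull_homotopicRel (fun e x => rfl) (fun e x => rfl)
    ⟨⟨H.toHomotopy, fun s p hp => H.eq_fst s (Or.inl hp)⟩⟩

variable [T1Space X] [LocallyCompactSpace X]

/-- Uncurrying gives a null homotopy that may move the base point of X; `homotopicRel_const` repairs
it. Null homotopies suffice, as injectivity of a homomorphism is tested on its kernel. -/
theorem equiv_const_of_adjoint (hX : X.WellPointed) {g : BasedMap V W}
    (h : (adjoint hq hS g).HomotopicRel (.const _ (X.mapNull W).pt) S) :
    g ≈ ⟨.const V W.pt, rfl⟩ := by
  refine hq.equiv_iff.2 (hX.homotopicRel_const (fun e => hq.apply_eq_pt g (Or.inr rfl)) ?_)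
  obtain ⟨H⟩ := h
  refine ⟨⟨⟨⟨fun p => (H (p.1, p.2.1)).1 p.2.2, ?_⟩, fun p => ?_, fun p => ?_⟩, fun s p hp => ?_⟩⟩
  · exact (continuous_subtype_val.comp (H.continuous.comp
      (f := fun p : I × (E × X) => (p.1, p.2.1)) (by fun_prop))).eval (by fun_prop)
  · exact congrArg (fun f : X.mapNull W => f.1 p.2) (H.apply_zero p.1)
  · exact congrArg (fun f : X.mapNull W => f.1 p.2) (H.apply_one p.1)
  · exact congrArg (fun f : X.mapNull W => f.1 p.2) (H.eq_fst s hp)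

theorem exists_homotopicRel_adjoint (hX : X.WellPointed) {p : C(E, X.mapNull W)}
    (hp : ∀ e ∈ S, p e = (X.mapNull W).pt)
    (h : ((evalMap X W X.pt).1.comp p).HomotopicRel (.const _ W.pt) S) :
    ∃ g : BasedMap V W, p.HomotopicRel (adjoint hq hS g) S := by
  let F : C(E × X, W) := ⟨fun d => (p d.1).1 d.2,
    (continuous_subtype_val.comp (p.continuous.comp continuous_fst)).eval continuous_snd⟩
  obtain ⟨G, hG, hFG⟩ := hX.exists_homotopicRel (S := S) (F := F) (y := W.pt)
    (fun d hd => congrArg (fun f : X.mapNull W => f.1 d.2) (hp d.1 hd)) h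
  obtain ⟨g, hg⟩ := hq.exists_lift G hG
  exact ⟨g, mapNull_homotopicRel (fun e x => rfl) (fun e x => hg (e, x)) hFG⟩

end Adjoint

/-! ### The adjunction on [ΣA, map(X, Z; 0)] -/

section Suspension

variable {A : BasedSpace.{u}} {X : BasedSpace.{v}} {Z : BasedSpace.{w}}

theorem isCollapse_susp (A : BasedSpace.{u}) :
    IsCollapse A.suspSet (fun p : A × I => (suspMk p.1 p.2 : A.susp)) :=
  isCollapse_mk (Or.inl rfl)

theorem isCollapse_susp_smash (A : BasedSpace.{u}) (X : BasedSpace.{v}) :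
    IsCollapse {p : (A × I) × X | p.1 ∈ A.suspSet ∨ p.2 = X.pt}
      (fun p => (suspMk (Quotient.mk (collapseSetoid _) (p.1.1, p.2)) p.1.2 :
        (A.smash X).susp)) := by
  have h : IsCollapse {p : A × X | p.1 = A.pt ∨ p.2 = X.pt} (V := A.smash X)
    (Quotient.mk (collapseSetoid _)) := isCollapse_mk (Or.inl rfl)
  -- Moving the suspension coordinate last means that the quotient map on A × X is only multiplied
  -- by I.
  convert h.susp.comp_homeomorph (T' := (A × I) × X)
    ⟨⟨fun p => ((p.1.1, p.2), p.1.2), fun p => ((p.1.1, p.2), p.1.2), fun _ => rfl, fun _ => rfl⟩,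
      by fun_prop, by fun_prop⟩ using 1
  · ext ⟨⟨a, t⟩, x⟩
    change ((a = A.pt ∨ t = 0 ∨ t = 1) ∨ x = X.pt) ↔ ((a = A.pt ∨ x = X.pt) ∨ t = 0 ∨ t = 1)
    tauto
  · rfl

theorem suspSet_joined (A : BasedSpace.{u}) (e : A × I) : ∃ e' ∈ A.suspSet, Joined e e' :=
  ⟨(e.1, 0), Or.inr (Or.inl rfl),
    (joined_zero e.2).map (f := fun t : I => (e.1, t)) (by fun_prop)⟩

/-- The homomorphism `[Σ(A ∧ X), Z] → [ΣA, map(X, Z; 0)]` given by adjunction. -/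
noncomputable def smashHom (A : BasedSpace.{u}) (X : BasedSpace.{v}) (Z : BasedSpace.{w}) :
    HomotopyClasses (A.smash X).susp Z →* HomotopyClasses A.susp (X.mapNull Z) :=
  MonoidHom.mk' (Quotient.map (fun g => suspLift
      (adjoint (isCollapse_susp_smash A X) (suspSet_joined A) g) fun _ => adjoint_of_mem _ _ g)
      fun _ _ h => (isCollapse_susp A).equiv_iff.2 (adjoint_congr (isCollapse_susp_smash A X) (suspSet_joined A) h)) (by
    rintro ⟨f⟩ ⟨g⟩
    refine congrArg (Quotient.mk _) (Subtype.ext (ContinuousMap.ext ?_))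
    rintro ⟨a, t⟩
    refine Subtype.ext (ContinuousMap.ext fun x => ?_)
    -- Concatenation of loops of maps is pointwise: evaluation at x commutes with it.
    have key := Path.map_trans
      (loopAt (suspLift (adjoint (isCollapse_susp_smash A X) (suspSet_joined A) f)
        fun _ => adjoint_of_mem _ _ f) a)
      (loopAt (suspLift (adjoint (isCollapse_susp_smash A X) (suspSet_joined A) g)
        fun _ => adjoint_of_mem _ _ g) a) (evalMap X Z x).1.continuous
    exact (DFunLike.congr_fun key t).symm)

theorem postcomp_smashHom {W : BasedSpace} (φ : BasedMap Z W)
    (a : HomotopyClasses (A.smash X).susp Z) :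
    postcomp A (mapNullMap X φ) (smashHom A X Z a) = smashHom A X W (postcomp _ φ a) := by
  obtain ⟨g⟩ := a
  refine congrArg (Quotient.mk _) (Subtype.ext (ContinuousMap.ext ?_))
  rintro ⟨a, t⟩
  rfl

theorem postcomp_evalMap_smashHom (a : HomotopyClasses (A.smash X).susp Z) :
    postcomp A (evalMap X Z X.pt) (smashHom A X Z a) = 1 := by
  obtain ⟨g⟩ := a
  refine congrArg (Quotient.mk _) (Subtype.ext (ContinuousMap.ext ?_))
  rintro ⟨a, t⟩
  exact (isCollapse_susp_smash A X).apply_eq_pt g (p := ((a, t), X.pt)) (Or.inr rfl)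

theorem smashHom_injective [T1Space X] [LocallyCompactSpace X] (hX : X.WellPointed) :
    Function.Injective (smashHom A X Z) := by
  refine (injective_iff_map_eq_one _).2 ?_
  rintro ⟨g⟩ h
  have h' : suspLift (adjoint (isCollapse_susp_smash A X) (suspSet_joined A) g)
    (fun _ => adjoint_of_mem _ _ g) ≈ suspOne := Quotient.exact h
  exact Quotient.sound (equiv_const_of_adjoint (isCollapse_susp_smash A X) (suspSet_joined A) hX
    ((isCollapse_susp A).equiv_iff.1 h'))

theorem exists_smashHom_eq [T1Space X] [LocallyCompactSpace X] (hX : X.WellPointed)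
    (p : HomotopyClasses A.susp (X.mapNull Z)) (hp : postcomp A (evalMap X Z X.pt) p = 1) :
    ∃ g, smashHom A X Z g = p := by
  obtain ⟨p⟩ := p
  have hp' : (evalMap X Z X.pt).comp p ≈ suspOne := Quotient.exact hp
  obtain ⟨g, hg⟩ := exists_homotopicRel_adjoint (isCollapse_susp_smash A X) (suspSet_joined A) hX
    (p := p.1.comp ⟨_, (isCollapse_susp A).isQuotientMap.continuous⟩)
    (fun e he => (isCollapse_susp A).apply_eq_pt p he)
    ((isCollapse_susp A).equiv_iff.1 hp')
  have hgp : suspLift (adjoint (isCollapse_susp_smash A X) (suspSet_joined A) g)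
    (fun _ => adjoint_of_mem _ _ g) ≈ p := (isCollapse_susp A).equiv_iff.2 hg.symm
  exact ⟨Quotient.mk _ g, Quotient.sound hgp⟩

end Suspension

/-! ### The adjunction on homotopy groups, via cubes -/

section Cube

/-- The class of a based map in `[A, Z]`. -/
def BasedMap.homotopyClass {A : BasedSpace.{u}} {Z : BasedSpace.{v}} (g : BasedMap A Z) :
    HomotopyClasses A Z := Quotient.mk _ g

theorem exists_homotopyClass_eq {A : BasedSpace.{u}} {Z : BasedSpace.{v}}
    (a : HomotopyClasses A Z) : ∃ g, BasedMap.homotopyClass g = a :=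
  Quotient.exists_rep a

/-- The map `Iⁿ × X → Σⁿ X` whose last suspension coordinate is the first cube coordinate. -/
def cubeMk (X : BasedSpace.{u}) : ∀ n : ℕ, (Fin n → I) × X → X.iterSusp n
  | 0, p => p.2
  | n + 1, p => suspMk (cubeMk X n (Fin.tail p.1, p.2)) (p.1 0)

theorem mem_boundary_succ {n : ℕ} {y : Fin (n + 1) → I} :
    y ∈ Cube.boundary (Fin (n + 1)) ↔
      Fin.tail y ∈ Cube.boundary (Fin n) ∨ y 0 = 0 ∨ y 0 = 1 := by
  simp only [Cube.boundary, Set.mem_ofPred_eq, Fin.exists_fin_succ, Fin.tail]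
  exact or_comm

theorem isCollapse_cubeMk (X : BasedSpace.{u}) (n : ℕ) :
    IsCollapse {p : (Fin n → I) × X | p.1 ∈ Cube.boundary (Fin n) ∨ p.2 = X.pt}
      (cubeMk X n) := by
  induction n with
  | zero =>
    have h := (isCollapse_id X).comp_homeomorph (T' := (Fin 0 → I) × X)
      ⟨⟨fun p => p.2, fun x => (default, x), fun p => Prod.ext (Subsingleton.elim _ _) rfl,
        fun _ => rfl⟩, by fun_prop, by fun_prop⟩
    refine (congrArg (IsCollapse (V := X) · fun p : (Fin 0 → I) × X => p.2) ?_).mpr h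
    ext p
    simp [Cube.boundary]
  | succ n ih =>
    have h := ih.susp.comp_homeomorph (T' := (Fin (n + 1) → I) × X)
      ⟨⟨fun p => ((Fin.tail p.1, p.2), p.1 0), fun p => (Fin.cons p.2 p.1.1, p.1.2),
        fun p => Prod.ext (Fin.cons_self_tail _) rfl, fun p => rfl⟩,
        by unfold Fin.tail; fun_prop, by fun_prop⟩
    refine (congrArg (IsCollapse (V := (X.iterSusp n).susp) · (cubeMk X (n + 1))) ?_).mpr h
    ext p
    change (p.1 ∈ Cube.boundary _ ∨ p.2 = X.pt) ↔
      ((Fin.tail p.1 ∈ Cube.boundary _ ∨ p.2 = X.pt) ∨ p.1 0 = 0 ∨ p.1 0 = 1)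
    rw [mem_boundary_succ]
    tauto

theorem boundary_joined {n : ℕ} (y : Fin (n + 1) → I) :
    ∃ y' ∈ Cube.boundary (Fin (n + 1)), Joined y y' :=
  ⟨Function.update y 0 0, ⟨0, Or.inl (by simp)⟩, by
    simpa using (joined_zero (y 0)).map (f := fun t : I => Function.update y 0 t) (by fun_prop)⟩

variable {X : BasedSpace.{u}} {Z : BasedSpace.{v}} {n : ℕ}

/-- The generalized loop in `map(X, Z; 0)` adjoint to a based map on `Σⁿ⁺¹ X`. -/
def cubeAdjoint (g : BasedMap (X.iterSusp n).susp Z) :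
    GenLoop (Fin (n + 1)) (X.mapNull Z) (X.mapNull Z).pt :=
  ⟨adjoint (isCollapse_cubeMk X (n + 1)) boundary_joined g, fun _ => adjoint_of_mem _ _ g⟩

theorem cubeAdjoint_apply (g : BasedMap (X.iterSusp n).susp Z) (y : Fin (n + 1) → I) (x : X) :
    (cubeAdjoint g y).1 x = g.1 (suspMk (cubeMk X n (Fin.tail y, x)) (y 0)) := rfl

/-- The outermost suspension coordinate is cube coordinate 0, so both sides concatenate in that
coordinate. -/
theorem cubeAdjoint_mul (f g : BasedMap (X.iterSusp n).susp Z) :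
    cubeAdjoint (suspMul f g) = GenLoop.transAt 0 (cubeAdjoint f) (cubeAdjoint g) := by
  refine GenLoop.ext _ _ fun y => Subtype.ext (ContinuousMap.ext fun x => ?_)
  let c := cubeMk X n (Fin.tail y, x)
  change (if (y 0 : ℝ) ≤ 1 / 2 then (loopAt f c).extend (2 * y 0)
      else (loopAt g c).extend (2 * y 0 - 1)) =
    (if (y 0 : ℝ) ≤ 1 / 2
      then cubeAdjoint f (Function.update y 0 (Set.projIcc 0 1 zero_le_one (2 * y 0)))
      else cubeAdjoint g (Function.update y 0 (Set.projIcc 0 1 zero_le_one (2 * y 0 - 1)))).1 x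
  split_ifs
  · rw [cubeAdjoint_apply, Fin.tail_update_zero, Function.update_self]
    rfl
  · rw [cubeAdjoint_apply, Fin.tail_update_zero, Function.update_self]
    rfl

/-- The map `[Σⁿ⁺¹ X, Z] → π_{n+1}(map(X, Z; 0))` given by adjunction. -/
def cubeClass (n : ℕ) (X : BasedSpace.{u}) (Z : BasedSpace.{v}) :
    HomotopyClasses (X.iterSusp n).susp Z → π_ (n + 1) (X.mapNull Z) (X.mapNull Z).pt :=
  Quotient.map cubeAdjoint fun _ _ h =>
    adjoint_congr (isCollapse_cubeMk X (n + 1)) boundary_joined h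

theorem cubeClass_mul (a b : HomotopyClasses (X.iterSusp n).susp Z) :
    cubeClass n X Z (a * b) = cubeClass n X Z b * cubeClass n X Z a := by
  obtain ⟨f⟩ := a
  obtain ⟨g⟩ := b
  exact (congrArg (Quotient.mk _) (cubeAdjoint_mul f g)).trans
    (HomotopyGroup.mul_spec (i := 0)).symm

/-- The homomorphism `[Σⁿ⁺¹ X, Z] → π_{n+1}(map(X, Z; 0))` given by adjunction and inversion;
inversion accounts for the order of multiplication in `π_{n+1}`. -/
noncomputable def cubeHom (n : ℕ) (X : BasedSpace.{u}) (Z : BasedSpace.{v}) :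
    HomotopyClasses (X.iterSusp n).susp Z →* π_ (n + 1) (X.mapNull Z) (X.mapNull Z).pt :=
  MonoidHom.mk' (fun a => cubeClass n X Z a⁻¹) fun a b => by rw [mul_inv_rev, cubeClass_mul]

theorem cubeHom_mk (g : BasedMap (X.iterSusp n).susp Z) :
    cubeHom n X Z (BasedMap.homotopyClass g)⁻¹ = Quotient.mk _ (cubeAdjoint g) :=
  congrArg (cubeClass n X Z) (inv_inv (BasedMap.homotopyClass g))

theorem exists_inv_mk (a : HomotopyClasses (X.iterSusp n).susp Z) :
    ∃ g, a = (BasedMap.homotopyClass g)⁻¹ := by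
  obtain ⟨g, hg⟩ : ∃ g, BasedMap.homotopyClass g = a⁻¹ := exists_homotopyClass_eq _
  exact ⟨g, by rw [hg, inv_inv]⟩

theorem piMap_cubeHom {W : BasedSpace.{w}} (φ : BasedMap Z W)
    (a : HomotopyClasses (X.iterSusp n).susp Z) :
    piMap (n + 1) (mapNullMap X φ) (cubeHom n X Z a) = cubeHom n X W (postcomp _ φ a) := by
  obtain ⟨g, rfl⟩ := exists_inv_mk a
  rw [cubeHom_mk, map_inv]
  exact (cubeHom_mk (φ.comp g)).symm

theorem piMap_evalMap_cubeHom (a : HomotopyClasses (X.iterSusp n).susp Z) :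
    piMap (n + 1) (evalMap X Z X.pt) (cubeHom n X Z a) = 1 := by
  obtain ⟨g, rfl⟩ := exists_inv_mk a
  rw [cubeHom_mk]
  exact congrArg (Quotient.mk _) (GenLoop.ext _ _ fun y =>
    (isCollapse_cubeMk X (n + 1)).apply_eq_pt g (p := (y, X.pt)) (Or.inr rfl))

theorem cubeHom_injective [T1Space X] [LocallyCompactSpace X] (hX : X.WellPointed) :
    Function.Injective (cubeHom n X Z) := by
  refine (injective_iff_map_eq_one _).2 fun a h => ?_
  obtain ⟨g, rfl⟩ := exists_inv_mk a
  have h' : GenLoop.Homotopic (cubeAdjoint g) GenLoop.const :=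
    Quotient.exact ((cubeHom_mk g).symm.trans h)
  refine inv_eq_one.2 (Quotient.sound ?_)
  exact equiv_const_of_adjoint (isCollapse_cubeMk X (n + 1)) boundary_joined hX h'

theorem exists_cubeHom_eq [T1Space X] [LocallyCompactSpace X] (hX : X.WellPointed)
    (p : π_ (n + 1) (X.mapNull Z) (X.mapNull Z).pt)
    (hp : piMap (n + 1) (evalMap X Z X.pt) p = 1) : ∃ g, cubeHom n X Z g = p := by
  obtain ⟨p⟩ := p
  have hp' := Quotient.exact hp
  obtain ⟨g, hg⟩ := exists_homotopicRel_adjoint (isCollapse_cubeMk X (n + 1)) boundary_joined hX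
    (p := p.1) p.2 hp'
  exact ⟨_, (cubeHom_mk g).trans (Quotient.sound hg.symm)⟩

end Cube

/-! ### Gottlieb groups of the mapping space as images of M(ω) -/

section Functoriality

variable {Z : BasedSpace.{u}} {Z' : BasedSpace.{v}} {Z'' : BasedSpace.{w}}

theorem postcomp_comp {A : BasedSpace} (φ : BasedMap Z' Z'') (ψ : BasedMap Z Z') :
    postcomp A (φ.comp ψ) = (postcomp A φ).comp (postcomp A ψ) := by
  ext ⟨f⟩
  rfl

theorem piMap_comp {n : ℕ} [NeZero n] (φ : BasedMap Z' Z'') (ψ : BasedMap Z Z') :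
    piMap n (φ.comp ψ) = (piMap n φ).comp (piMap n ψ) := by
  ext ⟨f⟩
  rfl

theorem genGottlieb_mapNull (A : BasedSpace.{w}) (X : BasedSpace.{u}) (Y : BasedSpace.{v})
    [LocallyCompactSpace X] [LocallyCompactSpace Y] [PathConnectedSpace Y] :
    A.genGottlieb (X.mapNull Y) = (postcomp A (mapNullMap X Y.omega)).range := by
  apply le_antisymm
  · rw [genGottlieb, ← mapNullMap_comp_autToMap, postcomp_comp]
    rintro _ ⟨a, rfl⟩
    exact ⟨_, rfl⟩
  · rw [genGottlieb, ← omega_comp_mapToAut, postcomp_comp]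
    rintro _ ⟨a, rfl⟩
    exact ⟨_, rfl⟩

theorem gottlieb_mapNull (n : ℕ) [NeZero n] (X : BasedSpace.{u}) (Y : BasedSpace.{v})
    [LocallyCompactSpace X] [LocallyCompactSpace Y] [PathConnectedSpace Y] :
    gottlieb n (X.mapNull Y) = (piMap n (mapNullMap X Y.omega)).range := by
  apply le_antisymm
  · rw [gottlieb, ← mapNullMap_comp_autToMap, piMap_comp]
    rintro _ ⟨a, rfl⟩
    exact ⟨_, rfl⟩
  · rw [gottlieb, ← omega_comp_mapToAut, piMap_comp]
    rintro _ ⟨a, rfl⟩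
    exact ⟨_, rfl⟩

end Functoriality

/-! ### Commutativity from a unital multiplication -/

section Commutativity

/-- The first projection. -/
def fstMap (Z : BasedSpace.{u}) (W : BasedSpace.{v}) : BasedMap (Z.prod W) Z :=
  ⟨⟨Prod.fst, continuous_fst⟩, rfl⟩

/-- The second projection. -/
def sndMap (Z : BasedSpace.{u}) (W : BasedSpace.{v}) : BasedMap (Z.prod W) W :=
  ⟨⟨Prod.snd, continuous_snd⟩, rfl⟩

/-- The inclusion of the first factor. -/
def inlMap (Z : BasedSpace.{u}) (W : BasedSpace.{v}) : BasedMap Z (Z.prod W) :=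
  ⟨⟨fun z => (z, W.pt), by fun_prop⟩, rfl⟩

/-- The inclusion of the second factor. -/
def inrMap (Z : BasedSpace.{u}) (W : BasedSpace.{v}) : BasedMap W (Z.prod W) :=
  ⟨⟨fun w => (Z.pt, w), by fun_prop⟩, rfl⟩

variable {Z : BasedSpace.{u}} {W : BasedSpace.{v}} {M : BasedSpace.{v}}

theorem postcomp_prod_ext {A : BasedSpace.{w}} {a b : HomotopyClasses A.susp (Z.prod W)}
    (h₁ : postcomp A (fstMap Z W) a = postcomp A (fstMap Z W) b)
    (h₂ : postcomp A (sndMap Z W) a = postcomp A (sndMap Z W) b) : a = b := by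
  obtain ⟨f⟩ := a
  obtain ⟨g⟩ := b
  obtain ⟨H₁⟩ : (fstMap Z W).comp f ≈ (fstMap Z W).comp g := Quotient.exact h₁
  obtain ⟨H₂⟩ : (sndMap Z W).comp f ≈ (sndMap Z W).comp g := Quotient.exact h₂
  exact Quotient.sound ⟨H₁.prod H₂⟩

theorem piMap_prod_ext {n : ℕ} [NeZero n] {a b : π_ n (Z.prod W) (Z.prod W).pt}
    (h₁ : piMap n (fstMap Z W) a = piMap n (fstMap Z W) b)
    (h₂ : piMap n (sndMap Z W) a = piMap n (sndMap Z W) b) : a = b := by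
  obtain ⟨f⟩ := a
  obtain ⟨g⟩ := b
  obtain ⟨H₁⟩ := Quotient.exact h₁
  obtain ⟨H₂⟩ := Quotient.exact h₂
  exact Quotient.sound ⟨H₁.prod H₂⟩

theorem UnitalMul.postcomp_mul_comm (μ : UnitalMul M) {A : BasedSpace.{w}}
    (a b : HomotopyClasses A.susp M) : a * b = b * a := by
  have hl : ∀ c, postcomp A μ.mul (postcomp A (inlMap M M) c) = c := by
    rintro ⟨f⟩
    exact congrArg (Quotient.mk _) (Subtype.ext (ContinuousMap.ext fun x => μ.mul_pt _))
  have hr : ∀ c, postcomp A μ.mul (postcomp A (inrMap M M) c) = c := by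
    rintro ⟨f⟩
    exact congrArg (Quotient.mk _) (Subtype.ext (ContinuousMap.ext fun x => μ.pt_mul _))
  have h11 : ∀ c, postcomp A (fstMap M M) (postcomp A (inlMap M M) c) = c := by
    rintro ⟨f⟩; rfl
  have h12 : ∀ c, postcomp A (fstMap M M) (postcomp A (inrMap M M) c) = 1 := by
    rintro ⟨f⟩; rfl
  have h21 : ∀ c, postcomp A (sndMap M M) (postcomp A (inlMap M M) c) = 1 := by
    rintro ⟨f⟩; rfl
  have h22 : ∀ c, postcomp A (sndMap M M) (postcomp A (inrMap M M) c) = c := by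
    rintro ⟨f⟩; rfl
  -- Classes from the two factors of M × M commute, as each projection kills one of them. Applying
  -- μ, which restricts to the identity on both factors, transfers this to M.
  have key : postcomp A (inlMap M M) a * postcomp A (inrMap M M) b =
      postcomp A (inrMap M M) b * postcomp A (inlMap M M) a :=
    postcomp_prod_ext (by simp [h11, h12]) (by simp [h21, h22])
  simpa [hl, hr] using congrArg (postcomp A μ.mul) key

theorem UnitalMul.piMap_mul_comm (μ : UnitalMul M) {n : ℕ} [NeZero n] (a b : π_ n M M.pt) :
    a * b = b * a := by
  have hl : ∀ c, piMap n μ.mul (piMap n (inlMap M M) c) = c := by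
    rintro ⟨f⟩
    exact congrArg (Quotient.mk _) (Subtype.ext (ContinuousMap.ext fun x => μ.mul_pt _))
  have hr : ∀ c, piMap n μ.mul (piMap n (inrMap M M) c) = c := by
    rintro ⟨f⟩
    exact congrArg (Quotient.mk _) (Subtype.ext (ContinuousMap.ext fun x => μ.pt_mul _))
  have h11 : ∀ c, piMap n (fstMap M M) (piMap n (inlMap M M) c) = c := by
    rintro ⟨f⟩; rfl
  have h12 : ∀ c, piMap n (fstMap M M) (piMap n (inrMap M M) c) = 1 := by
    rintro ⟨f⟩; rfl
  have h21 : ∀ c, piMap n (sndMap M M) (piMap n (inlMap M M) c) = 1 := by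
    rintro ⟨f⟩; rfl
  have h22 : ∀ c, piMap n (sndMap M M) (piMap n (inrMap M M) c) = c := by
    rintro ⟨f⟩; rfl
  have key : piMap n (inlMap M M) a * piMap n (inrMap M M) b =
      piMap n (inrMap M M) b * piMap n (inlMap M M) a :=
    piMap_prod_ext (by simp [h11, h12]) (by simp [h21, h22])
  simpa [hl, hr] using congrArg (piMap n μ.mul) key

end Commutativity

/-! ### Splitting the image of a map of split extensions -/

section Algebra

theorem isMulCommutative_range {G H : Type*} [Group G] [Group H] (f : G →* H)
    (hG : ∀ a b : G, a * b = b * a) : IsMulCommutative f.range := by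
  refine ⟨⟨?_⟩⟩
  rintro ⟨_, a, rfl⟩ ⟨_, b, rfl⟩
  exact Subtype.ext (by simp only [Subgroup.coe_mul, ← map_mul, hG a b])

/-- A natural splitting `P ≅ R × Q` induces a splitting of the images of a natural map. -/
theorem nonempty_range_mulEquiv_prod {P R Q P' R' Q' : Type*} [Group P] [Group R] [Group Q]
    [Group P'] [Group R'] [Group Q'] (a : P →* P') (b : R →* R') (c : Q →* Q')
    (r : P →* R) (s : R →* P) (k : Q →* P) (r' : P' →* R') (s' : R' →* P') (k' : Q' →* P')
    (hs : ∀ x, a (s x) = s' (b x)) (hk : ∀ x, a (k x) = k' (c x)) (hrs : ∀ x, r (s x) = x)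
    (hrs' : ∀ x, r' (s' x) = x) (hrk' : ∀ x, r' (k' x) = 1) (hk' : Function.Injective k')
    (hrk : ∀ p, r p = 1 → ∃ q, k q = p) (hP : ∀ p p' : P, p * p' = p' * p) :
    Nonempty (a.range ≃* b.range × c.range) := by
  have hmem : ∀ x : b.range × c.range, s' x.1 * k' x.2 ∈ a.range := by
    rintro ⟨⟨_, x, rfl⟩, ⟨_, y, rfl⟩⟩
    exact ⟨s x * k y, by rw [map_mul, hs, hk]⟩
  -- Both factors lift to the commutative group P, so they commute even though P' need not be
  -- commutative.
  have hcomm : ∀ (x : c.range) (y : b.range), k' x * s' y = s' y * k' x := by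
    rintro ⟨_, x, rfl⟩ ⟨_, y, rfl⟩
    rw [← hs, ← hk, ← map_mul, hP, map_mul]
  let Φ : b.range × c.range →* a.range := MonoidHom.mk' (fun x => ⟨s' x.1 * k' x.2, hmem x⟩) (by
    rintro ⟨x, y⟩ ⟨x', y'⟩
    refine Subtype.ext ?_
    change s' (x * x') * k' (y * y') = s' x * k' y * (s' x' * k' y')
    rw [map_mul, map_mul, mul_assoc, mul_assoc, ← mul_assoc (k' y), hcomm, mul_assoc])
  refine ⟨(MulEquiv.ofBijective Φ ⟨(injective_iff_map_eq_one _).2 ?_, ?_⟩).symm⟩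
  · rintro ⟨⟨x, hx⟩, ⟨y, hy⟩⟩ h
    have h' : s' x * k' y = 1 := congrArg Subtype.val h
    have hx' : x = 1 := by simpa [hrs', hrk'] using congrArg r' h'
    subst hx'
    have hy' : y = 1 := (injective_iff_map_eq_one k').1 hk' y (by simpa using h')
    subst hy'
    rfl
  · rintro ⟨_, p, rfl⟩
    -- Removing the section part of p leaves an element of ker r, which comes from Q.
    obtain ⟨q, hq⟩ := hrk ((s (r p))⁻¹ * p) (by simp [hrs])
    refine ⟨(⟨b (r p), r p, rfl⟩, ⟨c q, q, rfl⟩), Subtype.ext ?_⟩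
    change s' (b (r p)) * k' (c q) = a p
    rw [← hs, ← hk, ← map_mul, hq, mul_inv_cancel_left]

end Algebra

end BasedSpace

-- Since `genGottlieb` suspends its first argument once, `X.iterSusp n` is the right partner of
-- degree n + 1. In both halves the splitting for aut₁ Y maps to the one for Y under ω.
open BasedSpace in
theorem mainTheorem2 (X : BasedSpace.{u}) (Y : BasedSpace.{v})
    [T2Space X] [LocallyCompactSpace X] [ConnectedSpace X] (hX : X.WellPointed)
    [T2Space Y] [LocallyCompactSpace Y] [PathConnectedSpace Y] (hY : Y.WellPointed) :
    (∀ (A : BasedSpace.{w}) [T2Space A] [LocallyCompactSpace A], A.WellPointed →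
      IsMulCommutative (A.genGottlieb (X.mapNull Y)) ∧
      IsMulCommutative (A.genGottlieb Y) ∧
      IsMulCommutative ((A.smash X).genGottlieb Y) ∧
      Nonempty (A.genGottlieb (X.mapNull Y) ≃*
        A.genGottlieb Y × (A.smash X).genGottlieb Y)) ∧
    (∀ n : ℕ,
      IsMulCommutative (BasedSpace.gottlieb (n + 1) (X.mapNull Y)) ∧
      IsMulCommutative (BasedSpace.gottlieb (n + 1) Y) ∧
      IsMulCommutative ((X.iterSusp n).genGottlieb Y) ∧
      Nonempty (BasedSpace.gottlieb (n + 1) (X.mapNull Y) ≃*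
        BasedSpace.gottlieb (n + 1) Y × (X.iterSusp n).genGottlieb Y)) := by
  let μ := autOneMul Y
  let μ' := μ.mapNull X
  refine ⟨fun A _ _ _ => ?_, fun n => ?_⟩
  · rw [genGottlieb_mapNull]
    refine ⟨isMulCommutative_range _ μ'.postcomp_mul_comm,
      isMulCommutative_range _ μ.postcomp_mul_comm, isMulCommutative_range _ μ.postcomp_mul_comm,
      nonempty_range_mulEquiv_prod _ _ _ (postcomp A (evalMap X _ X.pt))
        (postcomp A (constMap X _)) (smashHom A X _) (postcomp A (evalMap X _ X.pt))
        (postcomp A (constMap X _)) (smashHom A X _) ?_ ?_ ?_ ?_ ?_ (smashHom_injective hX)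
        (exists_smashHom_eq hX) μ'.postcomp_mul_comm⟩
    · rintro ⟨f⟩; rfl
    · exact postcomp_smashHom _
    · rintro ⟨f⟩; rfl
    · rintro ⟨f⟩; rfl
    · exact postcomp_evalMap_smashHom
  · rw [gottlieb_mapNull]
    refine ⟨isMulCommutative_range _ μ'.piMap_mul_comm,
      isMulCommutative_range _ μ.piMap_mul_comm, isMulCommutative_range _ μ.postcomp_mul_comm,
      nonempty_range_mulEquiv_prod _ _ _ (piMap (n + 1) (evalMap X _ X.pt))
        (piMap (n + 1) (constMap X _)) (cubeHom n X _) (piMap (n + 1) (evalMap X _ X.pt))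
        (piMap (n + 1) (constMap X _)) (cubeHom n X _) ?_ ?_ ?_ ?_ ?_ (cubeHom_injective hX)
        (exists_cubeHom_eq hX) μ'.piMap_mul_comm⟩
    · rintro ⟨f⟩; rfl
    · exact piMap_cubeHom _
    · rintro ⟨f⟩; rfl
    · rintro ⟨f⟩; rfl
    · exact piMap_evalMap_cubeHom
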